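/- Let $H$ be a complex Hilbert space and let $B\subseteq M\subseteq \mathcal{B}(H)$ be finite von Neumann algebras containing the identity operator of $H$, such that $B'\cap M\subseteq B$, where $B'$ is the commutant of $B$. (A von Neumann algebra $N$ is finite if the only projection $e\in N$ for which there is $v\in N$ with $v^*v=1$ and $vv^*=e$ is $e=1$.) If $p\in M$ is a nonzero projection, then there exists a nonzero projection $q\in B$ which is equivalent in $M$ to a subprojection of $p$; that is, there are a projection $r\in M$ with $r\le p$ and an element $v\in M$ with $v^*v=q$ and $vv^*=r$. -/

import Mathlib

namespace VonNeumannAlgebra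

/-- Murray–von Neumann equivalence relative to `M`: the operators `e` and `f` are the initial and
the final projection of a partial isometry `v` belonging to `M`. (If `e` is a projection and
`v* v = e`, then `v` is a partial isometry and `v v*` is a projection in `M`.) -/
def MvNEquiv {H : Type*} [NormedAddCommGroup H] [InnerProductSpace ℂ H] [CompleteSpace H]
    (M : VonNeumannAlgebra H) (e f : H →L[ℂ] H) : Prop :=
  ∃ v ∈ M, star v * v = e ∧ v * star v = f

/-- A von Neumann algebra `M` is finite if its identity is a finite projection: the only
projection of `M` that is equivalent in `M` to the identity is the identity itself. -/
def IsFinite {H : Type*} [NormedAddCommGroup H] [InnerProductSpace ℂ H] [CompleteSpace H]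
    (M : VonNeumannAlgebra H) : Prop :=
  ∀ e ∈ M, IsStarProjection e → M.MvNEquiv 1 e → e = 1

end VonNeumannAlgebra

/-! Suppose that no nonzero projection of `B` is equivalent in `M` to a subprojection of `p`; the
goal is `p = 0`. The centre of `M` lies in `B' ∩ M ⊆ B`, so cutting by central projections stays
inside `B`. Comparison theory then gives, for every projection `q ∈ B`, a central `z` with `z q = q`
and `p z` equivalent to a subprojection of `q` (`exists_central_dominated`).

The main point is `exists_orthogonal_centralSupport_eq`. If a nonzero `q ∈ B` below the central
support `c` of `p` contained no two orthogonal nonzero projections of `B` with equal central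
supports, orthogonal projections of `B` under `q` would be centrally orthogonal in `M`. Then `q B q`
would commute with `q M q`, and the hypothesis on `B' ∩ M` would put every projection of `q M q`
into `B`, in particular the copy of `p z`: a contradiction.

An exhaustion argument gives both pieces the central support of `q`. Iterating from `c` produces
orthogonal `e₀, e₁, ...` in `B` with central support `c`, each dominating all of `p`. A finite
algebra has no room for infinitely many orthogonal copies of a nonzero `p`. -/

namespace VonNeumannAlgebra

open ContinuousLinearMap

/-! ### Range projections, partial isometries and their membership in a von Neumann algebra. -/

section SupProj

variable {H : Type*} [NormedAddCommGroup H] [InnerProductSpace ℂ H]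

/-- The linear span of the ranges of a set of operators. -/
def rangeSpan (S : Set (H →L[ℂ] H)) : Submodule ℂ H :=
  Submodule.span ℂ {x | ∃ s ∈ S, ∃ h, s h = x}

theorem apply_mem_rangeSpan {S : Set (H →L[ℂ] H)} {s : H →L[ℂ] H} (hs : s ∈ S) (h : H) :
    s h ∈ rangeSpan S :=
  Submodule.subset_span ⟨s, hs, h, rfl⟩

variable [CompleteSpace H]

/-- The projection onto the closed linear span of the ranges of a set of operators. -/
noncomputable def supProj (S : Set (H →L[ℂ] H)) : H →L[ℂ] H :=
  (rangeSpan S).topologicalClosure.starProjection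

theorem isStarProjection_supProj (S : Set (H →L[ℂ] H)) : IsStarProjection (supProj S) :=
  isStarProjection_starProjection

theorem supProj_mul {S : Set (H →L[ℂ] H)} {s : H →L[ℂ] H} (hs : s ∈ S) :
    supProj S * s = s := by
  ext h
  exact Submodule.starProjection_eq_self_iff.mpr
    (Submodule.le_topologicalClosure _ (apply_mem_rangeSpan hs h))

theorem mul_supProj_eq_zero {S : Set (H →L[ℂ] H)} {t : H →L[ℂ] H}
    (h : ∀ s ∈ S, t * s = 0) : t * supProj S = 0 := by
  have hle : (rangeSpan S).topologicalClosure ≤ LinearMap.ker (t : H →ₗ[ℂ] H) := by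
    refine Submodule.topologicalClosure_minimal _ ?_ t.isClosed_ker
    refine Submodule.span_le.mpr ?_
    rintro _ ⟨s, hs, x, rfl⟩
    exact DFunLike.congr_fun (h s hs) x
  ext x
  exact hle (Submodule.starProjection_apply_mem _ x)

/-- The hypothesis makes the span of the ranges invariant under `N'`; since `N'` is closed under
adjoints, the projection commutes with `N'`, hence lies in `N'' = N`. Taking `s' = s` covers `S ⊆
N`, and `t' = 1` covers sets stable under left multiplication by `N'`. -/
theorem supProj_mem {S : Set (H →L[ℂ] H)} (N : VonNeumannAlgebra H)
    (h : ∀ t ∈ N.commutant, ∀ s ∈ S, ∃ s' ∈ S, ∃ t', t * s = s' * t') : supProj S ∈ N := by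
  have key : ∀ t ∈ N.commutant, t * supProj S = supProj S * t * supProj S := by
    intro t ht
    rw [← sub_eq_zero]
    have : (t - supProj S * t) * supProj S = 0 := by
      refine mul_supProj_eq_zero fun s hs => ?_
      obtain ⟨s', hs', t', e⟩ := h t ht s hs
      rw [sub_mul, mul_assoc, e, ← mul_assoc, supProj_mul hs', sub_self]
    rwa [sub_mul] at this
  rw [← commutant_commutant N, mem_commutant_iff]
  intro t ht
  have h1 := key t ht
  have h2 := congrArg star (key (star t) (star_mem ht))
  have hs : star (supProj S) = supProj S := (isStarProjection_supProj S).isSelfAdjoint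
  simp only [star_mul, star_star, hs] at h2
  rw [h2, ← mul_assoc]
  exact h1

theorem mul_eq_zero_of_star_mul_self {V W : H →L[ℂ] H} (h : star V * V * W = 0) : V * W = 0 := by
  rw [← CStarRing.star_mul_self_eq_zero_iff, star_mul, mul_assoc, ← mul_assoc (star V), h, mul_zero]

/-- Families of operators with the same Gram matrix are intertwined by a partial isometry. -/
theorem exists_partialIsometry {ι : Type*} (A B : ι → H →L[ℂ] H)
    (h : ∀ i j, star (A i) * A j = star (B i) * B j) :
    ∃ V : H →L[ℂ] H, (∀ i, V * A i = B i) ∧ star V * V = supProj (Set.range A) := by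
  classical
  let S : (ι →₀ H) →ₗ[ℂ] H := Finsupp.lsum ℂ fun i => (A i : H →ₗ[ℂ] H)
  let T : (ι →₀ H) →ₗ[ℂ] H := Finsupp.lsum ℂ fun i => (B i : H →ₗ[ℂ] H)
  have hS : ∀ i x, S (Finsupp.single i x) = A i x := fun i x => by simp [S]
  have hT : ∀ i x, T (Finsupp.single i x) = B i x := fun i x => by simp [T]
  have hinner : ∀ f g, inner ℂ (S f) (S g) = inner ℂ (T f) (T g) := by
    intro f g
    induction f using Finsupp.induction_linear with
    | zero => simp
    | add f₁ f₂ h₁ h₂ => simp only [map_add, inner_add_left, h₁, h₂]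
    | single i x =>
      induction g using Finsupp.induction_linear with
      | zero => simp
      | add f₁ f₂ h₁ h₂ => simp only [map_add, inner_add_right, h₁, h₂]
      | single j y =>
        rw [hS, hS, hT, hT]
        have := congrArg (fun Z : H →L[ℂ] H => inner ℂ x (Z y)) (h i j)
        simpa [star_eq_adjoint, adjoint_inner_right] using this
  have hnorm : ∀ f, ‖S f‖ = ‖T f‖ := by
    intro f
    have := hinner f f
    rw [inner_self_eq_norm_sq_to_K, inner_self_eq_norm_sq_to_K] at this
    have h2 : ‖S f‖ ^ 2 = ‖T f‖ ^ 2 := by exact_mod_cast this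
    exact (sq_eq_sq₀ (norm_nonneg _) (norm_nonneg _)).mp h2
  set K := (rangeSpan (Set.range A)).topologicalClosure with hK
  have hSr : LinearMap.range S = rangeSpan (Set.range A) := by
    apply le_antisymm
    · rintro _ ⟨f, rfl⟩
      induction f using Finsupp.induction_linear with
      | zero => simp
      | add f₁ f₂ h₁ h₂ => rw [map_add]; exact add_mem h₁ h₂
      | single i x => rw [hS]; exact apply_mem_rangeSpan (Set.mem_range_self i) x
    · refine Submodule.span_le.mpr ?_
      rintro _ ⟨_, ⟨i, rfl⟩, x, rfl⟩
      exact LinearMap.mem_range.mpr ⟨Finsupp.single i x, hS i x⟩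
  have hSK : ∀ f, S f ∈ K := fun f =>
    Submodule.le_topologicalClosure _ (hSr.le (LinearMap.mem_range_self S f))
  let e : (ι →₀ H) →ₗ[ℂ] K := S.codRestrict K hSK
  have he : DenseRange e := by
    rintro ⟨x, hx⟩
    rw [closure_subtype]
    have hx' : x ∈ closure (rangeSpan (Set.range A) : Set H) := hx
    convert hx' using 2
    rw [← hSr]
    ext y
    simp only [Set.mem_image, Set.mem_range, SetLike.mem_coe, LinearMap.mem_range]
    constructor
    · rintro ⟨_, ⟨f, rfl⟩, rfl⟩; exact ⟨f, rfl⟩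
    · rintro ⟨f, rfl⟩; exact ⟨e f, ⟨f, rfl⟩, rfl⟩
  -- Equality of the Gram matrices makes `S f ↦ T f` well defined and isometric on a dense subspace
  -- of `K`.
  let U : K →L[ℂ] H := T.extendOfNorm e
  have hU : ∀ f, U (e f) = T f := LinearMap.extendOfNorm_eq he
    ⟨1, fun f => by rw [one_mul, ← hnorm]; rfl⟩
  have hUi : ∀ x y : K, inner ℂ (U x) (U y) = inner ℂ (x : H) (y : H) := by
    intro x y
    refine DenseRange.induction_on₂
      (p := fun x y : K => inner ℂ (U x) (U y) = inner ℂ (x : H) (y : H)) he ?_ ?_ x y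
    · exact isClosed_eq (by fun_prop) (by fun_prop)
    · intro f g
      rw [hU, hU, ← hinner]; rfl
  refine ⟨U ∘L K.orthogonalProjectionOnto, fun i => ?_, ?_⟩
  · ext x
    have h1 : K.orthogonalProjectionOnto (A i x) = e (Finsupp.single i x) := by
      have : A i x = ((e (Finsupp.single i x) : K) : H) := (hS i x).symm
      rw [this, Submodule.orthogonalProjectionOnto_mem_subspace_eq_self]
    change U (K.orthogonalProjectionOnto (A i x)) = _
    rw [h1, hU, hT]
  · refine ContinuousLinearMap.ext fun x => ext_inner_left ℂ fun y => ?_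
    rw [star_eq_adjoint, mul_apply_eq_comp, adjoint_inner_right]
    change inner ℂ (U (K.orthogonalProjectionOnto y)) (U (K.orthogonalProjectionOnto x)) =
      inner ℂ y (K.starProjection x)
    rw [hUi]
    change inner ℂ (K.starProjection y) (K.starProjection x) = _
    rw [Submodule.inner_starProjection_left_eq_right]
    congr 1
    exact DFunLike.congr_fun (isStarProjection_starProjection (U := K)).isIdempotentElem.eq x

/-- `t V` and `V t` agree on the range of every `A i`, hence on the initial space of `V`, whose
projection commutes with `t`. The index `j` may differ from `i` so that `t` can permute the family,
as happens when `N` is a commutant. -/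
theorem partialIsometry_mem {ι : Type*} {A B : ι → H →L[ℂ] H} {V : H →L[ℂ] H}
    (hV : ∀ i, V * A i = B i) (hVV : star V * V = supProj (Set.range A)) (N : VonNeumannAlgebra H)
    (h : ∀ t ∈ N.commutant, ∀ i, ∃ j t', t * A i = A j * t' ∧ t * B i = B j * t') : V ∈ N := by
  have hP : supProj (Set.range A) ∈ N := by
    refine supProj_mem N ?_
    rintro t ht _ ⟨i, rfl⟩
    obtain ⟨j, t', h1, -⟩ := h t ht i
    exact ⟨A j, ⟨j, rfl⟩, t', h1⟩
  have hid := (isStarProjection_supProj (Set.range A)).isIdempotentElem.eq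
  have hVP : V * supProj (Set.range A) = V := by
    have : V * (1 - supProj (Set.range A)) = 0 := by
      apply mul_eq_zero_of_star_mul_self
      rw [hVV, mul_sub, mul_one, hid, sub_self]
    rw [mul_sub, mul_one, sub_eq_zero] at this
    exact this.symm
  rw [← commutant_commutant N, mem_commutant_iff]
  intro t ht
  have h0 : (t * V - V * t) * supProj (Set.range A) = 0 := by
    refine mul_supProj_eq_zero ?_
    rintro _ ⟨i, rfl⟩
    obtain ⟨j, t', h1, h2⟩ := h t ht i
    rw [sub_mul, mul_assoc, hV, mul_assoc, h1, h2, ← mul_assoc, hV, sub_self]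
  have hc := mem_commutant_iff.mp ht _ hP
  rw [sub_mul, mul_assoc, hVP, mul_assoc, ← hc, ← mul_assoc, hVP] at h0
  exact sub_eq_zero.mp h0

end SupProj

/-- Zorn's lemma. Maximality is stated as membership, so each application must still show that the
new element cannot already lie in `F`. -/
theorem exists_maximal_pairwise {α : Type*} (P : α → Prop) (R : α → α → Prop) :
    ∃ F : Set α, (∀ x ∈ F, P x) ∧ F.Pairwise R ∧
      ∀ x, P x → (∀ y ∈ F, R x y ∧ R y x) → x ∈ F := by
  obtain ⟨F, hF⟩ := zorn_subset {F : Set α | (∀ x ∈ F, P x) ∧ F.Pairwise R} (by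
    intro c hc hchain
    refine ⟨⋃₀ c, ⟨?_, ?_⟩, fun s hs => Set.subset_sUnion_of_mem hs⟩
    · rintro x ⟨s, hs, hx⟩
      exact (hc hs).1 x hx
    · exact (Set.pairwise_sUnion hchain.directedOn).mpr fun s hs => (hc hs).2)
  refine ⟨F, hF.prop.1, hF.prop.2, fun x hx hR => ?_⟩
  have hins : insert x F ∈ {F : Set α | (∀ x ∈ F, P x) ∧ F.Pairwise R} := by
    refine ⟨?_, ?_⟩
    · rintro y (rfl | hy)
      exacts [hx, hF.prop.1 y hy]
    · exact hF.prop.2.insert fun y hy _ => hR y hy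
  exact hF.le_of_ge hins (Set.subset_insert x F) (Set.mem_insert x F)

/-! ### Comparison of projections. -/

section Comparison

variable {H : Type*} [NormedAddCommGroup H] [InnerProductSpace ℂ H] [CompleteSpace H]

theorem mul_star_mul_self_of_isStarProjection {v : H →L[ℂ] H} (hv : IsStarProjection (star v * v)) :
    v * (star v * v) = v := by
  have : v * (1 - star v * v) = 0 := by
    apply mul_eq_zero_of_star_mul_self
    rw [mul_sub, mul_one, hv.isIdempotentElem.eq, sub_self]
  rw [mul_sub, mul_one, sub_eq_zero] at this
  exact this.symm

theorem isStarProjection_mul_star {v : H →L[ℂ] H} (hv : IsStarProjection (star v * v)) :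
    IsStarProjection (v * star v) where
  isIdempotentElem := by
    change v * star v * (v * star v) = _
    rw [← mul_assoc, mul_assoc v, mul_star_mul_self_of_isStarProjection hv]
  isSelfAdjoint := IsSelfAdjoint.mul_star_self v

theorem mul_star_mem {M : VonNeumannAlgebra H} {v : H →L[ℂ] H} (hv : v ∈ M) : v * star v ∈ M :=
  mul_mem hv (star_mem hv)

theorem star_mul_mem {M : VonNeumannAlgebra H} {v : H →L[ℂ] H} (hv : v ∈ M) : star v * v ∈ M :=
  mul_mem (star_mem hv) hv

/-- A nonzero element of a corner `f M e` of a von Neumann algebra yields a nonzero partial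
isometry in the same corner. -/
theorem exists_partialIsometry_of_ne_zero (M : VonNeumannAlgebra H) {e f T : H →L[ℂ] H}
    (he : IsStarProjection e) (hT : T ∈ M) (hTe : T * e = T) (hfT : f * T = T) (hT0 : T ≠ 0) :
    ∃ u ∈ M, IsStarProjection (star u * u) ∧ u * e = u ∧ f * u = u ∧ u ≠ 0 := by
  set A := CFC.abs T with hA
  have hAA : A * A = star T * T := CFC.abs_mul_abs T
  have hAs : star A = A := (CFC.abs_nonneg T).isSelfAdjoint
  -- Polar decomposition: `|T|² = T* T` says that `|T|` and `T` have the same Gram operator.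
  obtain ⟨u, hu1, hu2⟩ := exists_partialIsometry (fun _ : Unit => A) (fun _ => T)
    (fun _ _ => by rw [hAs, hAA])
  have hu1 := hu1 ()
  have hP : IsStarProjection (star u * u) := hu2 ▸ isStarProjection_supProj _
  have huP := mul_star_mul_self_of_isStarProjection hP
  refine ⟨u, ?_, hP, ?_, ?_, ?_⟩
  · refine partialIsometry_mem (fun _ : Unit => hu1) hu2 M fun t ht _ => ⟨(), t, ?_, ?_⟩
    · refine (Commute.cfcAbs_left (a := T) (b := t) ?_ ?_).eq.symm
      · exact (mem_commutant_iff.mp ht) _ hT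
      · exact (mem_commutant_iff.mp (star_mem ht)) _ hT
    · exact ((mem_commutant_iff.mp ht) _ hT).symm
  · have h1 : A * (1 - e) = 0 := by
      apply mul_eq_zero_of_star_mul_self
      rw [hAs, hAA, mul_sub, mul_one, mul_assoc, hTe, sub_self]
    have h2 : (1 - e) * A = 0 := by
      have := congrArg star h1
      rwa [star_mul, hAs, star_sub, star_one, he.isSelfAdjoint.star_eq, star_zero] at this
    have h3 : (1 - e) * (star u * u) = 0 := by
      rw [hu2]
      refine mul_supProj_eq_zero ?_
      rintro _ ⟨_, rfl⟩
      exact h2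
    have h4 := congrArg star h3
    rw [star_mul, hP.isSelfAdjoint.star_eq, star_sub, star_one, he.isSelfAdjoint.star_eq,
      star_zero] at h4
    have h5 : u * (1 - e) = 0 := by
      rw [← huP, mul_assoc, h4, mul_zero]
    rw [mul_sub, mul_one, sub_eq_zero] at h5
    exact h5.symm
  · have h3 : ((1 - f) * u) * (star u * u) = 0 := by
      rw [hu2]
      refine mul_supProj_eq_zero ?_
      rintro _ ⟨_, rfl⟩
      rw [mul_assoc, hu1, sub_mul, one_mul, hfT, sub_self]
    rw [mul_assoc, huP, sub_mul, one_mul, sub_eq_zero] at h3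
    exact h3.symm
  · rintro rfl
    exact hT0 (by rw [← hu1, zero_mul])

/-- Comparison of projections up to centrally orthogonal remainders. -/
theorem exists_comparison (M : VonNeumannAlgebra H) {e f : H →L[ℂ] H} (he : IsStarProjection e)
    (hf : IsStarProjection f) (heM : e ∈ M) (hfM : f ∈ M) :
    ∃ v ∈ M, IsStarProjection (star v * v) ∧ v * e = v ∧ f * v = v ∧
      ∀ m ∈ M, (f - v * star v) * m * (e - star v * v) = 0 := by
  obtain ⟨F, hF, hFR, hmax⟩ := exists_maximal_pairwise
    (fun v : H →L[ℂ] H => v ∈ M ∧ IsStarProjection (star v * v) ∧ v * e = v ∧ f * v = v ∧ v ≠ 0)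
    (fun v w => star v * w = 0 ∧ v * star w = 0)
  have hadj : ∀ v ∈ F, star (star v * v) = star v * v := fun v hv =>
    (hF v hv).2.1.isSelfAdjoint.star_eq
  -- `V` serves as the strong sum of the family; mutual orthogonality of initial and of final spaces
  -- is what makes the Gram matrices agree.
  obtain ⟨V, hV1, hV2⟩ := exists_partialIsometry
    (fun v : F => star (v : H →L[ℂ] H) * (v : H →L[ℂ] H)) (fun v : F => (v : H →L[ℂ] H)) (by
      intro v w
      rw [hadj v v.2]
      by_cases hvw : v = w
      · subst hvw
        exact (hF v v.2).2.1.isIdempotentElem.eq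
      · have h := hFR v.2 w.2 (fun h => hvw (Subtype.ext h))
        rw [h.1, mul_assoc, ← mul_assoc (v : H →L[ℂ] H), h.2, zero_mul, mul_zero])
  have hVM : V ∈ M := partialIsometry_mem hV1 hV2 M fun t ht v => ⟨v, t,
    ((mem_commutant_iff.mp ht) _ (star_mul_mem (hF v v.2).1)).symm,
    ((mem_commutant_iff.mp ht) _ (hF v v.2).1).symm⟩
  have hP : IsStarProjection (star V * V) := hV2 ▸ isStarProjection_supProj _
  have hVP := mul_star_mul_self_of_isStarProjection hP
  have hVe : V * e = V := by
    have h1 : (1 - e) * (star V * V) = 0 := by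
      rw [hV2]
      refine mul_supProj_eq_zero ?_
      rintro _ ⟨v, rfl⟩
      have : e * star (v : H →L[ℂ] H) = star (v : H →L[ℂ] H) := by
        rw [← he.isSelfAdjoint.star_eq, ← star_mul, (hF v v.2).2.2.1]
      rw [← mul_assoc, sub_mul, one_mul, this, sub_self, zero_mul]
    have h2 := congrArg star h1
    rw [star_mul, hP.isSelfAdjoint.star_eq, star_sub, star_one, he.isSelfAdjoint.star_eq,
      star_zero] at h2
    have h3 : V * (1 - e) = 0 := by rw [← hVP, mul_assoc, h2, mul_zero]
    rw [mul_sub, mul_one, sub_eq_zero] at h3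
    exact h3.symm
  have hfV : f * V = V := by
    have h1 : ((1 - f) * V) * (star V * V) = 0 := by
      rw [hV2]
      refine mul_supProj_eq_zero ?_
      rintro _ ⟨v, rfl⟩
      rw [mul_assoc, hV1, sub_mul, one_mul, (hF v v.2).2.2.2.1, sub_self]
    rw [mul_assoc, hVP, sub_mul, one_mul, sub_eq_zero] at h1
    exact h1.symm
  have heV : e * star V = star V := by
    rw [← he.isSelfAdjoint.star_eq, ← star_mul, hVe]
  have hVf : star V * f = star V := by
    rw [← hf.isSelfAdjoint.star_eq, ← star_mul, hfV]
  refine ⟨V, hVM, hP, hVe, hfV, fun m hm => ?_⟩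
  by_contra hne
  have hQ := isStarProjection_mul_star hP
  have he' : IsStarProjection (e - star V * V) :=
    hP.sub_of_mul_eq_left he (by rw [mul_assoc, hVe])
  have hf' : IsStarProjection (f - V * star V) :=
    hQ.sub_of_mul_eq_left hf (by rw [mul_assoc, hVf])
  obtain ⟨u, huM, hu, hue, hfu, hu0⟩ := exists_partialIsometry_of_ne_zero M (f := f - V * star V) he'
    (mul_mem (mul_mem (sub_mem hfM (mul_star_mem hVM)) hm) (sub_mem heM (star_mul_mem hVM)))
    (by rw [mul_assoc, he'.isIdempotentElem.eq])
    (by rw [← mul_assoc, ← mul_assoc, hf'.isIdempotentElem.eq]) hne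
  -- The new `u` lives under the two remainders, so it is orthogonal to `V` on both sides and
  -- maximality puts it into `F`.
  have hVu : star V * u = 0 := by
    rw [← hfu, ← mul_assoc, mul_sub, hVf, ← mul_assoc]
    have := congrArg star hVP
    rw [star_mul, hP.isSelfAdjoint.star_eq] at this
    rw [this, sub_self, zero_mul]
  have huV : u * star V = 0 := by
    rw [← hue, mul_assoc, sub_mul, heV]
    have := congrArg star hVP
    rw [star_mul, hP.isSelfAdjoint.star_eq] at this
    rw [this, sub_self, mul_zero]
  have huV' : V * star u = 0 := by
    have := congrArg star huV
    rwa [star_mul, star_star, star_zero] at this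
  have huF : u ∈ F := by
    refine hmax u ⟨huM, hu, ?_, ?_, hu0⟩ fun y hy => ?_
    · rw [← hue, mul_assoc, sub_mul, he.isIdempotentElem.eq, mul_assoc, hVe]
    · rw [← hfu, ← mul_assoc, mul_sub, hf.isIdempotentElem.eq, ← mul_assoc, hfV]
    · have h1 : star y * u = 0 := by
        rw [← show V * (star y * y) = y from hV1 ⟨y, hy⟩, star_mul, mul_assoc, hVu, mul_zero]
      have h2 : u * star y = 0 := by
        have hyP : star V * V * star y = star y := by
          have h3 : star V * V * (star y * y) = star y * y := by
            rw [hV2]; exact supProj_mul ⟨⟨y, hy⟩, rfl⟩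
          have h4 := congrArg star (mul_star_mul_self_of_isStarProjection (hF y hy).2.1)
          rw [star_mul, hadj y hy] at h4
          rw [← h4, ← mul_assoc, h3]
        rw [← hyP, ← mul_assoc, ← mul_assoc, huV, zero_mul, zero_mul]
      refine ⟨⟨?_, h2⟩, h1, ?_⟩
      · have := congrArg star h1
        rwa [star_mul, star_star, star_zero] at this
      · have := congrArg star h2
        rwa [star_mul, star_star, star_zero] at this
  -- Membership gives `V (u* u) = u`, whereas `V u* = 0`.
  have h1 := hV1 ⟨u, huF⟩
  simp only at h1
  rw [← mul_assoc, huV', zero_mul] at h1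
  exact hu0 h1.symm

end Comparison

/-! ### Central supports and domination of central pieces of `p`. -/

section CentralSupport

variable {H : Type*} [NormedAddCommGroup H] [InnerProductSpace ℂ H] [CompleteSpace H]

theorem smul_mem (M : VonNeumannAlgebra H) {x : H →L[ℂ] H} (hx : x ∈ M) (c : ℂ) : c • x ∈ M :=
  M.toStarSubalgebra.smul_mem hx c

/-- The central support of an operator relative to `M`. -/
noncomputable def centralSupport (M : VonNeumannAlgebra H) (q : H →L[ℂ] H) : H →L[ℂ] H :=
  supProj {T | ∃ m ∈ M, m * q = T}

theorem isStarProjection_centralSupport (M : VonNeumannAlgebra H) (q : H →L[ℂ] H) :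
    IsStarProjection (M.centralSupport q) :=
  isStarProjection_supProj _

theorem centralSupport_mem {M : VonNeumannAlgebra H} {q : H →L[ℂ] H} (hq : q ∈ M) :
    M.centralSupport q ∈ M := by
  refine supProj_mem M ?_
  rintro t ht _ ⟨m, hm, rfl⟩
  exact ⟨m * q, ⟨m, hm, rfl⟩, t, ((mem_commutant_iff.mp ht) _ (mul_mem hm hq)).symm⟩

theorem centralSupport_mem_commutant (M : VonNeumannAlgebra H) (q : H →L[ℂ] H) :
    M.centralSupport q ∈ M.commutant := by
  refine supProj_mem M.commutant ?_
  rintro t ht _ ⟨m, hm, rfl⟩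
  rw [commutant_commutant] at ht
  exact ⟨t * m * q, ⟨t * m, mul_mem ht hm, rfl⟩, 1, by rw [mul_one, mul_assoc]⟩

theorem centralSupport_mul (M : VonNeumannAlgebra H) (q : H →L[ℂ] H) :
    M.centralSupport q * q = q :=
  supProj_mul ⟨1, one_mem M, one_mul q⟩

theorem mul_centralSupport_eq_zero {M : VonNeumannAlgebra H} {q t : H →L[ℂ] H}
    (h : ∀ m ∈ M, t * m * q = 0) : t * M.centralSupport q = 0 := by
  refine mul_supProj_eq_zero ?_
  rintro _ ⟨m, hm, rfl⟩
  rw [← mul_assoc, h m hm]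

theorem mul_centralSupport_eq_zero_of_mem_commutant {M : VonNeumannAlgebra H} {q t : H →L[ℂ] H}
    (ht : t ∈ M.commutant) (h : t * q = 0) : t * M.centralSupport q = 0 :=
  mul_centralSupport_eq_zero fun m hm => by
    rw [← mem_commutant_iff.mp ht m hm, mul_assoc, h, mul_zero]

theorem mul_centralSupport_eq_self_of_mem_commutant {M : VonNeumannAlgebra H} {q t : H →L[ℂ] H}
    (ht : t ∈ M.commutant) (h : t * q = q) : t * M.centralSupport q = M.centralSupport q := by
  have := mul_centralSupport_eq_zero_of_mem_commutant (q := q)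
    (sub_mem (one_mem M.commutant) ht) (by rw [sub_mul, one_mul, h, sub_self])
  rw [sub_mul, one_mul, sub_eq_zero] at this
  exact this.symm

theorem IsStarProjection.mul_eq_of_mul_eq {a e : H →L[ℂ] H} (ha : IsSelfAdjoint a)
    (he : IsStarProjection e) (h : a * e = a) : e * a = a := by
  have := congrArg star h
  rwa [star_mul, ha.star_eq, he.isSelfAdjoint.star_eq] at this

/-- If no nonzero projection of `B` is subequivalent to `p`, then every projection of `B`
dominates the part of `p` under some central projection above it. -/
theorem exists_central_dominated {B M : VonNeumannAlgebra H} (hBM : B ≤ M)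
    (hcomm : ∀ x ∈ M, x ∈ B.commutant → x ∈ B) {p : H →L[ℂ] H} (hpM : p ∈ M)
    (hp : IsStarProjection p)
    (hN : ∀ q ∈ B, IsStarProjection q → ∀ r ∈ M, IsStarProjection r → r * p = r →
      M.MvNEquiv q r → q = 0)
    {q : H →L[ℂ] H} (hqB : q ∈ B) (hq : IsStarProjection q) :
    ∃ z ∈ M, z ∈ M.commutant ∧ IsStarProjection z ∧ z * q = q ∧
      ∃ v ∈ M, star v * v = p * z ∧ q * v = v := by
  have hqM : q ∈ M := hBM hqB
  obtain ⟨v, hvM, hv, hvp, hqv, hortho⟩ := exists_comparison M hp hq hpM hqM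
  set Q := v * star v with hQ
  have hQproj : IsStarProjection Q := isStarProjection_mul_star hv
  have hQM : Q ∈ M := mul_star_mem hvM
  set z := M.centralSupport (q - Q) with hz
  have hzM : z ∈ M := centralSupport_mem (sub_mem hqM hQM)
  have hzM' : z ∈ M.commutant := centralSupport_mem_commutant _ _
  have hzp : IsStarProjection z := isStarProjection_centralSupport _ _
  have hzc : ∀ m ∈ M, m * z = z * m := mem_commutant_iff.mp hzM'
  have h1z : IsStarProjection (1 - z) := hzp.one_sub
  have h1zc : ∀ m ∈ M, m * (1 - z) = (1 - z) * m := fun m hm => by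
    rw [mul_sub, sub_mul, hzc m hm, mul_one, one_mul]
  have h1zM : 1 - z ∈ M := sub_mem (one_mem M) hzM
  have h1 : (1 - z) * q = (1 - z) * Q := by
    have : z * (q - Q) = q - Q := centralSupport_mul _ _
    rw [← sub_eq_zero, ← mul_sub, sub_mul, this, one_mul, sub_self]
  have h2 : (p - star v * v) * z = 0 := by
    refine mul_centralSupport_eq_zero fun m hm => ?_
    have := congrArg star (hortho _ (star_mem hm))
    rwa [star_mul, star_mul, star_star, star_sub, star_sub, hp.isSelfAdjoint.star_eq,
      hv.isSelfAdjoint.star_eq, hq.isSelfAdjoint.star_eq, hQproj.isSelfAdjoint.star_eq, star_zero,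
      ← mul_assoc] at this
  have h1zB : 1 - z ∈ B := hcomm _ h1zM (mem_commutant_iff.mpr fun b hb => h1zc b (hBM hb))
  -- Off `z` the projection `q` coincides with `v v*`, so `(1 - z) q ∈ B` is equivalent to `(1 - z)
  -- v* v ≤ p` and must vanish.
  have h3 : (1 - z) * q = 0 := by
    refine hN _ (mul_mem h1zB hqB) (h1z.mul hq (h1zc q hqM).symm)
      ((1 - z) * (star v * v)) (mul_mem h1zM (star_mul_mem hvM))
      (h1z.mul hv (h1zc _ (star_mul_mem hvM)).symm) ?_
      ⟨star v * (1 - z), mul_mem (star_mem hvM) h1zM, ?_, ?_⟩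
    · rw [mul_assoc, mul_assoc, hvp]
    · rw [star_mul, star_star, h1z.isSelfAdjoint.star_eq, h1, mul_assoc, ← mul_assoc v,
        ← hQ, h1zc Q hQM, ← mul_assoc, h1z.isIdempotentElem.eq]
    · rw [star_mul, star_star, h1z.isSelfAdjoint.star_eq, h1zc _ (star_mem hvM), mul_assoc,
        ← mul_assoc (star v), h1zc _ (star_mem hvM), mul_assoc, ← mul_assoc,
        h1z.isIdempotentElem.eq]
  have h4 : z * q = q := by
    rw [sub_mul, one_mul, sub_eq_zero] at h3
    exact h3.symm
  refine ⟨z, hzM, hzM', hzp, h4, v, hvM, ?_, hqv⟩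
  rw [sub_mul, sub_eq_zero] at h2
  have hzv : z * v = v := by rw [← hqv, ← mul_assoc, h4]
  rw [h2, mul_assoc, hzc v hvM, hzv]

end CentralSupport

/-! ### The relative commutant in a corner, and approximation by projections. -/

section Corner

variable {H : Type*} [NormedAddCommGroup H] [InnerProductSpace ℂ H] [CompleteSpace H]

/-- A projection of the corner `q M q` commuting with `q B q` belongs to `B` when
`B' ∩ M ⊆ B`. -/
theorem mem_of_commute_corner {B M : VonNeumannAlgebra H} (hBM : B ≤ M)
    (hcomm : ∀ x ∈ M, x ∈ B.commutant → x ∈ B) {q e : H →L[ℂ] H} (hqB : q ∈ B)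
    (hq : IsStarProjection q) (heM : e ∈ M) (he : IsStarProjection e) (heq : e * q = e)
    (hce : ∀ b ∈ B, q * b * q * e = e * (q * b * q)) : e ∈ B := by
  have hqe := IsStarProjection.mul_eq_of_mul_eq he.isSelfAdjoint hq heq
  have hqq := hq.isIdempotentElem.eq
  have hee := he.isIdempotentElem.eq
  -- The symmetry `2e - q` of the corner replaces `e`: since `x² = q`, the map `b q ↦ b x` preserves
  -- Gram matrices.
  set x := e + e - q with hx
  have hxM : x ∈ M := sub_mem (add_mem heM heM) (hBM hqB)
  have hxs : star x = x := by
    rw [hx, star_sub, star_add, he.isSelfAdjoint.star_eq, hq.isSelfAdjoint.star_eq]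
  have hqx : q * x = x := by rw [hx, mul_sub, mul_add, hqe, hqq]
  have hxq : x * q = x := by rw [hx, sub_mul, add_mul, heq, hqq]
  have hxx : x * x = q := by
    rw [hx]
    simp only [mul_sub, sub_mul, mul_add, add_mul, hee, heq, hqe, hqq]
    abel
  have hcx : ∀ b ∈ B, q * b * q * x = x * (q * b * q) := fun b hb => by
    rw [hx, mul_sub, mul_add, sub_mul, add_mul, hce b hb, mul_assoc (q * b), hqq, ← mul_assoc q,
      ← mul_assoc q, hqq]
  obtain ⟨U, hU1, hU2⟩ := exists_partialIsometry (fun b : B => (b : H →L[ℂ] H) * q)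
    (fun b : B => (b : H →L[ℂ] H) * x) (by
      intro b c
      have hbc : star (b : H →L[ℂ] H) * c ∈ B := mul_mem (star_mem b.2) c.2
      calc star ((b : H →L[ℂ] H) * q) * ((c : H →L[ℂ] H) * q)
          = q * (star (b : H →L[ℂ] H) * c) * q := by
            rw [star_mul, hq.isSelfAdjoint.star_eq]; simp only [mul_assoc]
        _ = q * (star (b : H →L[ℂ] H) * c) * q * (x * x) := by
            rw [hxx, mul_assoc _ q q, hqq]
        _ = x * (q * (star (b : H →L[ℂ] H) * c) * q) * x := by
            rw [← mul_assoc, hcx _ hbc]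
        _ = (x * q) * (star (b : H →L[ℂ] H) * c) * (q * x) := by simp only [mul_assoc]
        _ = star ((b : H →L[ℂ] H) * x) * ((c : H →L[ℂ] H) * x) := by
            rw [hxq, hqx, star_mul, hxs]; simp only [mul_assoc])
  have hUM : U ∈ M := partialIsometry_mem hU1 hU2 M fun t ht b => ⟨b, t,
    (mem_commutant_iff.mp ht _ (mul_mem (hBM b.2) (hBM hqB))).symm,
    (mem_commutant_iff.mp ht _ (mul_mem (hBM b.2) hxM)).symm⟩
  -- Left multiplication by `t ∈ B` moves the index `b` to `t b` in both families.
  have hUB' : U ∈ B.commutant := partialIsometry_mem hU1 hU2 B.commutant fun t ht b => by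
    rw [commutant_commutant] at ht
    exact ⟨⟨t * b, mul_mem ht b.2⟩, 1, by simp only [mul_assoc, mul_one],
      by simp only [mul_assoc, mul_one]⟩
  have hUq : U * q = x := by
    have := hU1 ⟨1, one_mem B⟩
    simpa only [one_mul] using this
  have hxB : x ∈ B := hUq ▸ mul_mem (hcomm U hUM hUB') hqB
  have h2 : (2⁻¹ : ℂ) • (x + q) = e := by
    rw [hx, sub_add_cancel, ← two_smul ℂ e, smul_smul]
    norm_num
  exact h2 ▸ smul_mem B (add_mem hxB hqB) _

/-- One step of the dyadic expansion of a positive contraction into projections. -/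
theorem exists_dyadic_projection (B : VonNeumannAlgebra H) {b : H →L[ℂ] H} (hbB : b ∈ B)
    (hb0 : 0 ≤ b) (hb1 : b ≤ 1) :
    ∃ e ∈ B, IsStarProjection e ∧ 0 ≤ b + b - e ∧ b + b - e ≤ 1 := by
  set a := b + b - 1 with ha
  have haB : a ∈ B := sub_mem (add_mem hbB hbB) (one_mem B)
  have hasa : IsSelfAdjoint a :=
    ((hb0.isSelfAdjoint.add hb0.isSelfAdjoint).sub (IsSelfAdjoint.one _))
  set c := a⁺ with hc
  set d := a⁻ with hd
  have hc0 : 0 ≤ c := CFC.posPart_nonneg a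
  have hd0 : 0 ≤ d := CFC.negPart_nonneg a
  have hcd : c * d = 0 := CFC.posPart_mul_negPart a
  have hdc : d * c = 0 := CFC.negPart_mul_posPart a
  have hsub : c - d = a := CFC.posPart_sub_negPart a
  have hcB : c ∈ B := by
    rw [← commutant_commutant B, mem_commutant_iff]
    intro t ht
    rw [hc, CFC.posPart_def]
    exact (Commute.cfcₙ_real (mem_commutant_iff.mp ht a haB) _).eq.symm
  -- `e` is the spectral projection of `b` for the part above `1/2`, the first binary digit of `b`.
  set e := supProj {c} with he
  have hep : IsStarProjection e := isStarProjection_supProj _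
  have heB : e ∈ B := by
    refine supProj_mem B ?_
    rintro t ht _ rfl
    exact ⟨c, rfl, t, (mem_commutant_iff.mp ht _ hcB).symm⟩
  have hec : e * c = c := supProj_mul rfl
  have hce : c * e = c := by
    have := congrArg star hec
    rwa [star_mul, hc0.isSelfAdjoint.star_eq, hep.isSelfAdjoint.star_eq] at this
  have hde : d * e = 0 := mul_supProj_eq_zero (by rintro _ rfl; exact hdc)
  have hed : e * d = 0 := by
    have := congrArg star hde
    rwa [star_mul, hd0.isSelfAdjoint.star_eq, hep.isSelfAdjoint.star_eq, star_zero] at this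
  have hee := hep.isIdempotentElem.eq
  have hbb : b + b = 1 + c - d := by rw [add_sub_assoc, hsub, ha]; abel
  refine ⟨e, heB, hep, ?_, ?_⟩
  · have h1 : b + b - e = (1 - e) * (b + b) * (1 - e) + c := by
      rw [hbb]
      simp only [mul_sub, sub_mul, mul_add, add_mul, mul_one, one_mul, hee, hec, hce, hde, hed]
      simp only [zero_mul]
      abel
    rw [h1]
    exact add_nonneg (hep.one_sub.isSelfAdjoint.conjugate_nonneg (add_nonneg hb0 hb0)) hc0
  · have h1 : 1 - (b + b - e) = e * (1 + 1 - (b + b)) * e + d := by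
      rw [hbb]
      simp only [mul_sub, sub_mul, mul_add, add_mul, mul_one, hee, hec, hce, hed]
      simp only [zero_mul]
      abel
    rw [← sub_nonneg, h1]
    exact add_nonneg (hep.isSelfAdjoint.conjugate_nonneg
      (sub_nonneg.mpr (add_le_add hb1 hb1))) hd0

/-- An operator commuting with all projections of `B` below `q` commutes with the positive
contractions of `B` supported by `q`. -/
theorem norm_commutator_le_of_commute_projections (B : VonNeumannAlgebra H) {q y : H →L[ℂ] H}
    (hq : IsStarProjection q)
    (hy : ∀ e ∈ B, IsStarProjection e → e * q = e → e * y = y * e) (n : ℕ) :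
    ∀ b ∈ B, 0 ≤ b → b ≤ 1 → b * q = b → ‖b * y - y * b‖ ≤ (1 / 2) ^ n * (2 * ‖y‖) := by
  induction n with
  | zero =>
    intro b _ hb0 hb1 _
    have hn : ‖b‖ ≤ 1 := (CStarAlgebra.norm_le_one_iff_of_nonneg b hb0).mpr hb1
    calc ‖b * y - y * b‖ ≤ ‖b‖ * ‖y‖ + ‖y‖ * ‖b‖ :=
          (norm_sub_le _ _).trans (add_le_add (norm_mul_le _ _) (norm_mul_le _ _))
      _ ≤ (1 / 2) ^ 0 * (2 * ‖y‖) := by nlinarith [norm_nonneg y]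
  | succ n ih =>
    intro b hbB hb0 hb1 hbq
    obtain ⟨e, heB, he, h0, h1⟩ := exists_dyadic_projection B hbB hb0 hb1
    have heq : e * q = e := by
      -- Compressing `0 ≤ 2b - e` to `1 - q` kills `b`, so this positive operator is also at most
      -- `0`.
      have hz : (1 - q) * e * (1 - q) = 0 := by
        refine le_antisymm ?_ (hq.one_sub.isSelfAdjoint.conjugate_nonneg he.nonneg)
        have := hq.one_sub.isSelfAdjoint.conjugate_nonneg h0
        have h2 : (1 - q) * (b + b - e) * (1 - q) = -((1 - q) * e * (1 - q)) := by
          have hb : (b + b) * (1 - q) = 0 := by rw [mul_sub, mul_one, add_mul, hbq, sub_self]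
          rw [mul_assoc, sub_mul (b + b) e, hb, zero_sub, mul_neg, mul_assoc]
        rw [h2] at this
        exact neg_nonneg.mp this
      have : e * (1 - q) = 0 := by
        rw [← CStarRing.star_mul_self_eq_zero_iff, star_mul, hq.one_sub.isSelfAdjoint.star_eq,
          he.isSelfAdjoint.star_eq, ← mul_assoc, mul_assoc _ e e, he.isIdempotentElem.eq, hz]
      rw [mul_sub, mul_one, sub_eq_zero] at this
      exact this.symm
    have hb' := ih (b + b - e) (sub_mem (add_mem hbB hbB) heB) h0 h1
      (by rw [sub_mul, add_mul, hbq, heq])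
    -- `e` commutes with `y`, so removing one binary digit doubles the commutator while the
    -- remainder is again a contraction.
    have h3 : (b + b - e) * y - y * (b + b - e) = (2 : ℝ) • (b * y - y * b) := by
      rw [sub_mul, mul_sub, add_mul, mul_add, hy e heB he heq, two_smul]
      abel
    rw [h3, norm_smul, Real.norm_of_nonneg zero_le_two] at hb'
    rw [pow_succ]
    linarith

theorem commute_corner_of_commute_projections (B : VonNeumannAlgebra H) {q y : H →L[ℂ] H}
    (hqB : q ∈ B) (hq : IsStarProjection q)
    (hy : ∀ e ∈ B, IsStarProjection e → e * q = e → e * y = y * e) {b : H →L[ℂ] H} (hb : b ∈ B) :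
    q * b * q * y = y * (q * b * q) := by
  have hqq := hq.isIdempotentElem.eq
  have contraction : ∀ b ∈ B, 0 ≤ b → b ≤ 1 → b * q = b → Commute b y := by
    intro b hb h0 h1 hbq
    have hlim : Filter.Tendsto (fun n : ℕ => (1 / 2 : ℝ) ^ n * (2 * ‖y‖)) Filter.atTop (nhds 0) := by
      simpa using (tendsto_pow_atTop_nhds_zero_of_lt_one (r := (1 / 2 : ℝ)) (by norm_num)
        (by norm_num)).mul_const (2 * ‖y‖)
    have := ge_of_tendsto' hlim fun n =>
      norm_commutator_le_of_commute_projections B hq hy n b hb h0 h1 hbq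
    exact sub_eq_zero.mp (norm_le_zero_iff.mp this)
  have nonneg : ∀ b ∈ B, 0 ≤ b → Commute (q * b * q) y := by
    intro b hb h0
    have hc0 : 0 ≤ q * b * q := hq.isSelfAdjoint.conjugate_nonneg h0
    rcases eq_or_ne (q * b * q) 0 with hz | hz
    · rw [hz]; exact Commute.zero_left y
    have hn : 0 < ‖q * b * q‖ := norm_pos_iff.mpr hz
    have hs0 : 0 ≤ (‖q * b * q‖⁻¹ : ℝ) • (q * b * q) := smul_nonneg (inv_nonneg.mpr hn.le) hc0
    have h := contraction ((‖q * b * q‖⁻¹ : ℝ) • (q * b * q))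
      (smul_mem B (mul_mem (mul_mem hqB hb) hqB) ((‖q * b * q‖⁻¹ : ℝ) : ℂ)) hs0
      ((CStarAlgebra.norm_le_one_iff_of_nonneg _ hs0).mp (by
        rw [norm_smul, norm_inv, norm_norm, inv_mul_cancel₀ hn.ne']))
      (by rw [smul_mul_assoc, mul_assoc _ q q, hqq])
    have h' := h.smul_left ‖q * b * q‖
    rwa [smul_smul, mul_inv_cancel₀ hn.ne', one_smul] at h'
  have selfAdjoint : ∀ b ∈ B, IsSelfAdjoint b → Commute (q * b * q) y := by
    intro b hb hsa
    have h1 := nonneg (b + algebraMap ℝ (H →L[ℂ] H) ‖b‖)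
      (add_mem hb (by
        rw [Algebra.algebraMap_eq_smul_one]
        exact smul_mem B (one_mem B) (‖b‖ : ℂ)))
      (by
        have := hsa.neg_algebraMap_norm_le_self
        rwa [neg_le_iff_add_nonneg] at this)
    have h2 : Commute q y := hy q hqB hq hqq
    have h4 : q * (b + algebraMap ℝ (H →L[ℂ] H) ‖b‖) * q - ‖b‖ • q = q * b * q := by
      rw [mul_add, add_mul, Algebra.algebraMap_eq_smul_one, mul_smul_comm, mul_one, smul_mul_assoc,
        hqq, add_sub_cancel_right]
    exact h4 ▸ h1.sub_left (h2.smul_left ‖b‖)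
  have h1 := selfAdjoint (b + star b) (add_mem hb (star_mem hb)) (IsSelfAdjoint.add_star_self b)
  have h2 := selfAdjoint (Complex.I • (b - star b)) (smul_mem B (sub_mem hb (star_mem hb)) _) (by
    rw [IsSelfAdjoint, star_smul, star_sub, star_star, Complex.star_def, Complex.conj_I, neg_smul,
      ← smul_neg, neg_sub])
  have h3 := (h1.sub_left (h2.smul_left Complex.I)).smul_left (2⁻¹ : ℂ)
  have h4 : (2⁻¹ : ℂ) • (q * (b + star b) * q - Complex.I • (q * (Complex.I • (b - star b)) * q))
      = q * b * q := by
    rw [mul_smul_comm, smul_mul_assoc, smul_smul, Complex.I_mul_I, neg_one_smul, sub_neg_eq_add,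
      ← add_mul, ← mul_add, add_add_sub_cancel, ← two_smul ℂ b, mul_smul_comm, smul_mul_assoc,
      smul_smul, inv_mul_cancel₀ two_ne_zero, one_smul]
  rw [h4] at h3
  exact h3.eq

end Corner

/-! ### Finiteness, splitting of projections of `B`, and the contradiction. -/

section Finite

variable {H : Type*} [NormedAddCommGroup H] [InnerProductSpace ℂ H] [CompleteSpace H]

theorem supProj_mem_of_subset {S : Set (H →L[ℂ] H)} (N : VonNeumannAlgebra H)
    (h : ∀ s ∈ S, s ∈ N) : supProj S ∈ N :=
  supProj_mem N fun t ht s hs => ⟨s, hs, t, (mem_commutant_iff.mp ht s (h s hs)).symm⟩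

/-- A finite von Neumann algebra contains no infinite sequence of pairwise orthogonal equivalent
nonzero projections. -/
theorem IsFinite.eq_zero_of_orthogonal_sequence {M : VonNeumannAlgebra H} (hM : M.IsFinite)
    {p : H →L[ℂ] H} (v : ℕ → H →L[ℂ] H) (hv : ∀ n, v n ∈ M) (hvp : ∀ n, star (v n) * v n = p)
    (hvv : ∀ m n, m ≠ n → star (v m) * v n = 0) : p = 0 := by
  set P := supProj (Set.range v) with hP
  have hPp : IsStarProjection P := isStarProjection_supProj _
  have hPM : P ∈ M := supProj_mem_of_subset M (by rintro _ ⟨n, rfl⟩; exact hv n)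
  have hP1 : ∀ n, (1 - P) * v n = 0 := fun n => by
    rw [sub_mul, one_mul, supProj_mul (Set.mem_range_self n), sub_self]
  have hP1s : star (1 - P) = 1 - P := hPp.one_sub.isSelfAdjoint.star_eq
  have hP2 : ∀ n, star (v n) * (1 - P) = 0 := fun n => by
    have := congrArg star (hP1 n)
    rwa [star_mul, hP1s, star_zero] at this
  let A : Option ℕ → H →L[ℂ] H := fun i => i.elim (1 - P) v
  -- Hilbert hotel: the shift `v n ↦ v (n + 1)`, fixing the complement `1 - P`, is an isometry in
  -- `M` whose range misses that of `v 0`.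
  let B : Option ℕ → H →L[ℂ] H := fun i => i.elim (1 - P) fun n => v (n + 1)
  have hgram : ∀ i j, star (A i) * A j = star (B i) * B j := by
    rintro (_ | m) (_ | n)
    · rfl
    · change star (1 - P) * v n = star (1 - P) * v (n + 1)
      rw [hP1s, hP1, hP1]
    · change star (v m) * (1 - P) = star (v (m + 1)) * (1 - P)
      rw [hP2, hP2]
    · change star (v m) * v n = star (v (m + 1)) * v (n + 1)
      rcases eq_or_ne m n with rfl | h
      · rw [hvp, hvp]
      · rw [hvv m n h, hvv _ _ (by simpa using h)]
  obtain ⟨V, hV1, hV2⟩ := exists_partialIsometry A B hgram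
  have hVM : V ∈ M := by
    refine partialIsometry_mem hV1 hV2 M fun t ht i => ⟨i, t, ?_, ?_⟩
    · refine (mem_commutant_iff.mp ht (A i) ?_).symm
      rcases i with _ | n
      exacts [sub_mem (one_mem M) hPM, hv n]
    · refine (mem_commutant_iff.mp ht (B i) ?_).symm
      rcases i with _ | n
      exacts [sub_mem (one_mem M) hPM, hv (n + 1)]
  have hone : supProj (Set.range A) = 1 := by
    have h1 : ∀ i, (1 - supProj (Set.range A)) * A i = 0 := fun i => by
      rw [sub_mul, one_mul, supProj_mul (Set.mem_range_self i), sub_self]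
    have h2 : (1 - supProj (Set.range A)) * P = 0 :=
      mul_supProj_eq_zero (by rintro _ ⟨n, rfl⟩; exact h1 (some n))
    have h3 : (1 - supProj (Set.range A)) * (1 - P) = 0 := h1 none
    rw [mul_sub, h2, mul_one, sub_zero, sub_eq_zero] at h3
    exact h3.symm
  rw [hone] at hV2
  have hVV : V * star V = 1 :=
    hM _ (mul_star_mem hVM) (isStarProjection_mul_star (hV2 ▸ .one _)) ⟨V, hVM, hV2, rfl⟩
  have h0 : star (v 0) * V = 0 := by
    have : star (v 0) * V * supProj (Set.range A) = 0 := by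
      refine mul_supProj_eq_zero ?_
      rintro _ ⟨i, rfl⟩
      rw [mul_assoc, hV1]
      rcases i with _ | n
      exacts [hP2 0, hvv 0 (n + 1) (Nat.succ_ne_zero n).symm]
    rwa [hone, mul_one] at this
  rw [← hvp 0, ← mul_one (star (v 0)), ← hVV, ← mul_assoc, h0, zero_mul, zero_mul]

theorem IsStarProjection.eq_of_mul_eq {e f : H →L[ℂ] H} (he : IsStarProjection e)
    (hf : IsStarProjection f) (h1 : e * f = f) (h2 : f * e = e) : e = f := by
  have := congrArg star h1
  rw [star_mul, he.isSelfAdjoint.star_eq, hf.isSelfAdjoint.star_eq] at this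
  exact h2.symm.trans this

theorem star_mul_eq_zero_comm {e f : H →L[ℂ] H} (he : IsStarProjection e)
    (hf : IsStarProjection f) (h : e * f = 0) : f * e = 0 := by
  have := congrArg star h
  rwa [star_mul, he.isSelfAdjoint.star_eq, hf.isSelfAdjoint.star_eq, star_zero] at this

theorem centralSupport_zero (M : VonNeumannAlgebra H) : M.centralSupport 0 = 0 := by
  have := mul_centralSupport_eq_zero (M := M) (q := 0) (t := 1) fun m _ => mul_zero _
  rwa [one_mul] at this

theorem centralSupport_of_mem_commutant {M : VonNeumannAlgebra H} {z : H →L[ℂ] H}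
    (hz : z ∈ M.commutant) (hzp : IsStarProjection z) : M.centralSupport z = z :=
  IsStarProjection.eq_of_mul_eq (isStarProjection_centralSupport M z) hzp (centralSupport_mul M z)
    (mul_centralSupport_eq_self_of_mem_commutant hz hzp.isIdempotentElem.eq)

theorem centralSupport_central_mul {M : VonNeumannAlgebra H} {w q : H →L[ℂ] H} (hwM : w ∈ M)
    (hwM' : w ∈ M.commutant) (hw : IsStarProjection w) (hqM : q ∈ M) :
    M.centralSupport (w * q) = w * M.centralSupport q := by
  have hsM : M.centralSupport q ∈ M := centralSupport_mem hqM
  have hsM' := centralSupport_mem_commutant M q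
  have hsp := isStarProjection_centralSupport M q
  have htM' := centralSupport_mem_commutant M (w * q)
  have hws := mem_commutant_iff.mp hsM' w hwM
  refine IsStarProjection.eq_of_mul_eq (isStarProjection_centralSupport M _) (hw.mul hsp hws) ?_ ?_
  · have h1 : (1 - M.centralSupport (w * q)) * w * M.centralSupport q = 0 := by
      refine mul_centralSupport_eq_zero_of_mem_commutant
        (mul_mem (sub_mem (one_mem M.commutant) htM') hwM') ?_
      rw [mul_assoc, sub_mul, one_mul, centralSupport_mul, sub_self]
    rw [mul_assoc, sub_mul, one_mul, sub_eq_zero] at h1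
    exact h1.symm
  · refine mul_centralSupport_eq_self_of_mem_commutant (mul_mem hwM' hsM') ?_
    rw [mul_assoc, ← mul_assoc _ w q, ← hws, mul_assoc w, centralSupport_mul, ← mul_assoc,
      hw.isIdempotentElem.eq]

/-- If no nonzero projection of `B` is subequivalent to `p`, then every nonzero projection of `B`
below the central support of `p` contains two orthogonal nonzero projections of `B` with the same
central support in `M`. -/
theorem exists_orthogonal_centralSupport_eq {B M : VonNeumannAlgebra H} (hBM : B ≤ M)
    (hcomm : ∀ x ∈ M, x ∈ B.commutant → x ∈ B) {p : H →L[ℂ] H} (hpM : p ∈ M)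
    (hp : IsStarProjection p)
    (hN : ∀ q ∈ B, IsStarProjection q → ∀ r ∈ M, IsStarProjection r → r * p = r →
      M.MvNEquiv q r → q = 0)
    {q : H →L[ℂ] H} (hqB : q ∈ B) (hq : IsStarProjection q) (hq0 : q ≠ 0)
    (hqp : M.centralSupport p * q = q) :
    ∃ q₁ ∈ B, ∃ q₂ ∈ B, IsStarProjection q₁ ∧ IsStarProjection q₂ ∧ q₁ * q = q₁ ∧ q₂ * q = q₂ ∧
      q₁ * q₂ = 0 ∧ q₁ ≠ 0 ∧ M.centralSupport q₁ = M.centralSupport q₂ := by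
  by_contra hno
  have hZB : ∀ w ∈ M, w ∈ M.commutant → w ∈ B := fun w hw hw' =>
    hcomm w hw (mem_commutant_iff.mpr fun b hb => mem_commutant_iff.mp hw' b (hBM hb))
  have hqq := hq.isIdempotentElem.eq
  have horth : ∀ q₁ ∈ B, ∀ q₂ ∈ B, IsStarProjection q₁ → IsStarProjection q₂ → q₁ * q = q₁ →
      q₂ * q = q₂ → q₁ * q₂ = 0 → ∀ m ∈ M, q₁ * m * q₂ = 0 := by
    intro q₁ h₁B q₂ h₂B h₁ h₂ h₁q h₂q h₁₂ m hm
    set z₁ := M.centralSupport q₁ with hz₁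
    set z₂ := M.centralSupport q₂ with hz₂
    have hz₁M : z₁ ∈ M := centralSupport_mem (hBM h₁B)
    have hz₂M : z₂ ∈ M := centralSupport_mem (hBM h₂B)
    have hz₁M' : z₁ ∈ M.commutant := centralSupport_mem_commutant M q₁
    have hz₂M' : z₂ ∈ M.commutant := centralSupport_mem_commutant M q₂
    have hz₁p : IsStarProjection z₁ := isStarProjection_centralSupport M q₁
    have hz₂p : IsStarProjection z₂ := isStarProjection_centralSupport M q₂
    have hzz : z₁ * z₂ = z₂ * z₁ := mem_commutant_iff.mp hz₂M' z₁ hz₁M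
    -- Cutting both projections by `w` gives them the same central support `w`, so the assumption
    -- `hno` forces `w = 0`.
    set w := z₁ * z₂ with hw
    have hwM : w ∈ M := mul_mem hz₁M hz₂M
    have hwM' : w ∈ M.commutant := mul_mem hz₁M' hz₂M'
    have hwp : IsStarProjection w := hz₁p.mul hz₂p hzz
    have hwB := hZB w hwM hwM'
    have hwc : ∀ b ∈ B, b * w = w * b := fun b hb => mem_commutant_iff.mp hwM' b (hBM hb)
    have hs₁ : M.centralSupport (w * q₁) = w := by
      rw [centralSupport_central_mul hwM hwM' hwp (hBM h₁B), ← hz₁, hzz, mul_assoc,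
        hz₁p.isIdempotentElem.eq]
    have hs₂ : M.centralSupport (w * q₂) = w := by
      rw [centralSupport_central_mul hwM hwM' hwp (hBM h₂B), ← hz₂, hw, mul_assoc,
        hz₂p.isIdempotentElem.eq]
    have hr : w * q₁ = 0 := by
      by_contra h0
      refine hno ⟨w * q₁, mul_mem hwB h₁B, w * q₂, mul_mem hwB h₂B,
        hwp.mul h₁ (hwc q₁ h₁B).symm, hwp.mul h₂ (hwc q₂ h₂B).symm, ?_, ?_, ?_, h0, ?_⟩
      · rw [mul_assoc, h₁q]
      · rw [mul_assoc, h₂q]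
      · rw [mul_assoc, ← mul_assoc q₁, hwc q₁ h₁B, mul_assoc w q₁, h₁₂, mul_zero, mul_zero]
      · rw [hs₁, hs₂]
    have hw0 : w = 0 := by rw [← hs₁, hr, centralSupport_zero]
    have e₁ : q₁ * z₁ = q₁ := by
      rw [mem_commutant_iff.mp hz₁M' q₁ (hBM h₁B), hz₁, centralSupport_mul]
    have e₂ : z₂ * q₂ = q₂ := centralSupport_mul M q₂
    calc q₁ * m * q₂ = q₁ * (z₁ * m) * (z₂ * q₂) := by rw [e₂, ← mul_assoc q₁, e₁]
      _ = q₁ * m * w * q₂ := by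
        rw [← mem_commutant_iff.mp hz₁M' m hm, hw]; simp only [mul_assoc]
      _ = 0 := by rw [hw0, mul_zero, zero_mul]
  obtain ⟨z, hzM, hzM', hzp, hzq, v, hvM, hvv, hqv⟩ :=
    exists_central_dominated hBM hcomm hpM hp hN hqB hq
  have hpz : IsStarProjection (p * z) := hp.mul hzp (mem_commutant_iff.mp hzM' p hpM)
  have he : IsStarProjection (v * star v) := isStarProjection_mul_star (hvv ▸ hpz)
  have heM : v * star v ∈ M := mul_star_mem hvM
  have hqe : q * (v * star v) = v * star v := by rw [← mul_assoc, hqv]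
  have heq : v * star v * q = v * star v := by
    have := congrArg star hqe
    rwa [star_mul, he.isSelfAdjoint.star_eq, hq.isSelfAdjoint.star_eq] at this
  have heB : v * star v ∈ B := by
    refine mem_of_commute_corner hBM hcomm hqB hq heM he heq fun b hb =>
      commute_corner_of_commute_projections B hqB hq (fun e heB he' heq' => ?_) hb
    have hqe' := IsStarProjection.mul_eq_of_mul_eq he'.isSelfAdjoint hq heq'
    have hee := he'.isIdempotentElem.eq
    have hqe1 : IsStarProjection (q - e) := he'.sub_of_mul_eq_left hq heq'
    have hqeq : (q - e) * q = q - e := by rw [sub_mul, hqq, heq']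
    have h1 := horth e heB (q - e) (sub_mem hqB heB) he' hqe1 heq' hqeq
      (by rw [mul_sub, heq', hee, sub_self]) _ heM
    have h2 := horth (q - e) (sub_mem hqB heB) e heB hqe1 he' hqeq heq'
      (by rw [sub_mul, hqe', hee, sub_self]) _ heM
    -- With `y = v v*`, the two vanishing corners read `e y = e y e` and `y e = e y e`.
    rw [mul_sub, mul_assoc, heq, sub_eq_zero] at h1
    rw [sub_mul, sub_mul, hqe, sub_eq_zero] at h2
    rw [h1, h2]
  have he0 : v * star v = 0 := by
    refine hN _ heB he (p * z) (mul_mem hpM hzM) hpz ?_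
      ⟨star v, star_mem hvM, by rw [star_star], by rw [star_star, hvv]⟩
    rw [mul_assoc, ← mem_commutant_iff.mp hzM' p hpM, ← mul_assoc, hp.isIdempotentElem.eq]
  have hv0 : v = 0 := by
    rw [← star_eq_zero, ← CStarRing.star_mul_self_eq_zero_iff, star_star, he0]
  have hzp0 : z * p = 0 := by
    rw [← mem_commutant_iff.mp hzM' p hpM, ← hvv, hv0, mul_zero]
  have hzc : z * M.centralSupport p = 0 := mul_centralSupport_eq_zero_of_mem_commutant hzM' hzp0
  apply hq0
  rw [← hzq, ← hqp, ← mul_assoc, hzc, zero_mul]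

/-- Under the hypotheses of `exists_orthogonal_centralSupport_eq`, the two orthogonal projections
can be chosen with full central support. -/
theorem exists_orthogonal_full_centralSupport {B M : VonNeumannAlgebra H} (hBM : B ≤ M)
    (hcomm : ∀ x ∈ M, x ∈ B.commutant → x ∈ B) {p : H →L[ℂ] H} (hpM : p ∈ M)
    (hp : IsStarProjection p)
    (hN : ∀ q ∈ B, IsStarProjection q → ∀ r ∈ M, IsStarProjection r → r * p = r →
      M.MvNEquiv q r → q = 0)
    {q : H →L[ℂ] H} (hqB : q ∈ B) (hq : IsStarProjection q)
    (hqp : M.centralSupport p * q = q) :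
    ∃ q₁ ∈ B, ∃ q₂ ∈ B, IsStarProjection q₁ ∧ IsStarProjection q₂ ∧ q₁ * q = q₁ ∧ q₂ * q = q₂ ∧
      q₁ * q₂ = 0 ∧ M.centralSupport q₁ = M.centralSupport q ∧
      M.centralSupport q₂ = M.centralSupport q := by
  obtain ⟨F, hF, hFR, hmax⟩ := exists_maximal_pairwise
    (fun x : (H →L[ℂ] H) × (H →L[ℂ] H) => x.1 ∈ B ∧ x.2 ∈ B ∧ IsStarProjection x.1 ∧
      IsStarProjection x.2 ∧ x.1 * q = x.1 ∧ x.2 * q = x.2 ∧ x.1 * x.2 = 0 ∧ x.1 ≠ 0 ∧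
      M.centralSupport x.1 = M.centralSupport x.2)
    -- Only first against second components need be orthogonal: `Q₁` and `Q₂` are suprema, so the
    -- members of one side may overlap.
    (fun x y => x.1 * y.2 = 0)
  set Q₁ := supProj (Prod.fst '' F) with hQ₁
  set Q₂ := supProj (Prod.snd '' F) with hQ₂
  have hQ₁p : IsStarProjection Q₁ := isStarProjection_supProj _
  have hQ₂p : IsStarProjection Q₂ := isStarProjection_supProj _
  have hQ₁B : Q₁ ∈ B := supProj_mem_of_subset B (by rintro _ ⟨x, hx, rfl⟩; exact (hF x hx).1)
  have hQ₂B : Q₂ ∈ B := supProj_mem_of_subset B (by rintro _ ⟨x, hx, rfl⟩; exact (hF x hx).2.1)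
  have hQ₁x : ∀ x ∈ F, Q₁ * x.1 = x.1 := fun x hx => supProj_mul ⟨x, hx, rfl⟩
  have hQ₂x : ∀ x ∈ F, Q₂ * x.2 = x.2 := fun x hx => supProj_mul ⟨x, hx, rfl⟩
  have hle : ∀ a : (H →L[ℂ] H) × (H →L[ℂ] H) → H →L[ℂ] H,
      (∀ x ∈ F, IsStarProjection (a x) ∧ a x * q = a x) →
      supProj (a '' F) * q = supProj (a '' F) := by
    intro a ha
    have h1 : (1 - q) * supProj (a '' F) = 0 := by
      refine mul_supProj_eq_zero ?_
      rintro _ ⟨x, hx, rfl⟩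
      rw [sub_mul, one_mul, IsStarProjection.mul_eq_of_mul_eq (ha x hx).1.isSelfAdjoint hq
        (ha x hx).2, sub_self]
    have h2 := star_mul_eq_zero_comm hq.one_sub (isStarProjection_supProj _) h1
    rw [mul_sub, mul_one, sub_eq_zero] at h2
    exact h2.symm
  have hQ₁q : Q₁ * q = Q₁ := hle _ fun x hx => ⟨(hF x hx).2.2.1, (hF x hx).2.2.2.2.1⟩
  have hQ₂q : Q₂ * q = Q₂ := hle _ fun x hx => ⟨(hF x hx).2.2.2.1, (hF x hx).2.2.2.2.2.1⟩
  have hQQ : Q₁ * Q₂ = 0 := by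
    refine star_mul_eq_zero_comm hQ₂p hQ₁p (mul_supProj_eq_zero ?_)
    rintro _ ⟨x, hx, rfl⟩
    refine star_mul_eq_zero_comm (hF x hx).2.2.1 hQ₂p (mul_supProj_eq_zero ?_)
    rintro _ ⟨y, hy, rfl⟩
    rcases eq_or_ne x y with rfl | hxy
    exacts [(hF x hx).2.2.2.2.2.2.1, hFR hx hy hxy]
  have hsupp : ∀ a b : (H →L[ℂ] H) × (H →L[ℂ] H) → H →L[ℂ] H,
      (∀ x ∈ F, M.centralSupport (a x) = M.centralSupport (b x)) →
      M.centralSupport (supProj (a '' F)) * M.centralSupport (supProj (b '' F)) =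
        M.centralSupport (supProj (b '' F)) := by
    intro a b hab
    refine mul_centralSupport_eq_self_of_mem_commutant (centralSupport_mem_commutant M _) ?_
    have ht : 1 - M.centralSupport (supProj (a '' F)) ∈ M.commutant :=
      sub_mem (one_mem _) (centralSupport_mem_commutant M _)
    have h1 : (1 - M.centralSupport (supProj (a '' F))) * supProj (b '' F) = 0 := by
      refine mul_supProj_eq_zero ?_
      rintro _ ⟨x, hx, rfl⟩
      rw [← centralSupport_mul M (b x), ← hab x hx, ← mul_assoc,
        mul_centralSupport_eq_zero_of_mem_commutant ht, zero_mul]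
      have : supProj (a '' F) * a x = a x := supProj_mul ⟨x, hx, rfl⟩
      rw [← this, ← mul_assoc, sub_mul, one_mul, centralSupport_mul, sub_self, zero_mul]
    rw [sub_mul, one_mul, sub_eq_zero] at h1
    exact h1.symm
  have hs₁₂ : M.centralSupport Q₁ = M.centralSupport Q₂ :=
    IsStarProjection.eq_of_mul_eq (isStarProjection_centralSupport M _)
      (isStarProjection_centralSupport M _)
      (hsupp _ _ fun x hx => (hF x hx).2.2.2.2.2.2.2.2)
      (hsupp _ _ fun x hx => (hF x hx).2.2.2.2.2.2.2.2.symm)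
  set w := M.centralSupport Q₁ with hw
  have hwM : w ∈ M := centralSupport_mem (hBM hQ₁B)
  have hwM' : w ∈ M.commutant := centralSupport_mem_commutant M Q₁
  have hwp : IsStarProjection w := isStarProjection_centralSupport M Q₁
  have hwB : w ∈ B :=
    hcomm w hwM (mem_commutant_iff.mpr fun b hb => mem_commutant_iff.mp hwM' b (hBM hb))
  have hwq : q * w = w * q := mem_commutant_iff.mp hwM' q (hBM hqB)
  have hc1 : q * (1 - w) = (1 - w) * q := by rw [mul_sub, sub_mul, hwq, mul_one, one_mul]
  have hww : (1 - w) * w = 0 := hwp.one_sub_mul_self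
  have hw1 : ∀ x ∈ F, w * x.1 = x.1 := fun x hx => by
    rw [← hQ₁x x hx, ← mul_assoc, centralSupport_mul]
  have hw2 : ∀ x ∈ F, w * x.2 = x.2 := fun x hx => by
    rw [← hQ₂x x hx, ← mul_assoc, hs₁₂, centralSupport_mul]
  have hq' : (1 - w) * q = 0 := by
    by_contra h0
    -- A pair found under `(1 - w) q` is compatible with `F`, hence in `F`, hence also under `w`:
    -- its first member would be zero.
    have hq'p : IsStarProjection ((1 - w) * q) := hwp.one_sub.mul hq hc1.symm
    have hcw : M.centralSupport p * (1 - w) = (1 - w) * M.centralSupport p :=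
      (mem_commutant_iff.mp (centralSupport_mem_commutant M p) _
        (sub_mem (one_mem M) hwM)).symm
    obtain ⟨r₁, h₁B, r₂, h₂B, h₁, h₂, h₁q, h₂q, h₁₂, h₁0, hs⟩ :=
      exists_orthogonal_centralSupport_eq hBM hcomm hpM hp hN
        (mul_mem (sub_mem (one_mem B) hwB) hqB) hq'p h0 (by
          rw [← mul_assoc, hcw, mul_assoc, hqp])
    have hq'q : (1 - w) * q * q = (1 - w) * q := by rw [mul_assoc, hq.isIdempotentElem.eq]
    have hann : ∀ r y : H →L[ℂ] H, r * ((1 - w) * q) = r → w * y = y → r * y = 0 := by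
      intro r y hr hy
      rw [← hr, ← hy, ← hc1, mul_assoc, mul_assoc, ← mul_assoc _ w, hww, zero_mul, mul_zero,
        mul_zero]
    have hrF : (r₁, r₂) ∈ F := by
      refine hmax _ ⟨h₁B, h₂B, h₁, h₂, ?_, ?_, h₁₂, h₁0, hs⟩ fun y hy => ⟨?_, ?_⟩
      · change r₁ * q = r₁
        rw [← h₁q, mul_assoc, hq'q]
      · change r₂ * q = r₂
        rw [← h₂q, mul_assoc, hq'q]
      · exact hann _ _ h₁q (hw2 y hy)
      · exact star_mul_eq_zero_comm h₂ (hF y hy).2.2.1 (hann _ _ h₂q (hw1 y hy))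
    have h3 : r₁ * r₁ = 0 := hann _ _ h₁q (hw1 _ hrF)
    exact h₁0 (by rw [← h3, h₁.isIdempotentElem.eq])
  have hwq1 : w * q = q := by
    rw [sub_mul, one_mul, sub_eq_zero] at hq'
    exact hq'.symm
  have hfull : w = M.centralSupport q := by
    refine IsStarProjection.eq_of_mul_eq hwp (isStarProjection_centralSupport M q)
      (mul_centralSupport_eq_self_of_mem_commutant hwM' hwq1)
      (mul_centralSupport_eq_self_of_mem_commutant (centralSupport_mem_commutant M q) ?_)
    rw [← IsStarProjection.mul_eq_of_mul_eq hQ₁p.isSelfAdjoint hq hQ₁q, ← mul_assoc,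
      centralSupport_mul]
  exact ⟨Q₁, hQ₁B, Q₂, hQ₂B, hQ₁p, hQ₂p, hQ₁q, hQ₂q, hQQ, hfull, hs₁₂ ▸ hfull⟩

theorem eq_zero_of_no_subequivalent {B M : VonNeumannAlgebra H} (hBM : B ≤ M) (hM : M.IsFinite)
    (hcomm : ∀ x ∈ M, x ∈ B.commutant → x ∈ B) {p : H →L[ℂ] H} (hpM : p ∈ M)
    (hp : IsStarProjection p)
    (hN : ∀ q ∈ B, IsStarProjection q → ∀ r ∈ M, IsStarProjection r → r * p = r →
      M.MvNEquiv q r → q = 0) : p = 0 := by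
  set c := M.centralSupport p with hc
  have hcM : c ∈ M := centralSupport_mem hpM
  have hcM' : c ∈ M.commutant := centralSupport_mem_commutant M p
  have hcp : IsStarProjection c := isStarProjection_centralSupport M p
  have hcB : c ∈ B :=
    hcomm c hcM (mem_commutant_iff.mpr fun b hb => mem_commutant_iff.mp hcM' b (hBM hb))
  let X := {f : H →L[ℂ] H // f ∈ B ∧ IsStarProjection f ∧ M.centralSupport f = c}
  have hsplit : ∀ f : X, ∃ x : X × X, x.1.1 * f.1 = x.1.1 ∧ x.2.1 * f.1 = x.2.1 ∧
      x.1.1 * x.2.1 = 0 := by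
    rintro ⟨f, hfB, hf, hfc⟩
    obtain ⟨q₁, h₁B, q₂, h₂B, h₁, h₂, h₁q, h₂q, h₁₂, hs₁, hs₂⟩ :=
      exists_orthogonal_full_centralSupport hBM hcomm hpM hp hN hfB hf
        (by rw [← hc, ← hfc, centralSupport_mul])
    exact ⟨(⟨q₁, h₁B, h₁, hs₁.trans hfc⟩, ⟨q₂, h₂B, h₂, hs₂.trans hfc⟩), h₁q, h₂q, h₁₂⟩
  choose s hs₁ hs₂ hs₁₂ using hsplit
  -- Of each splitting, the second half is split again and the first is kept as `e n`.
  let f : ℕ → X := fun n => Nat.rec ⟨c, hcB, hcp, centralSupport_of_mem_commutant hcM' hcp⟩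
    (fun _ g => (s g).2) n
  have hf : ∀ n, f (n + 1) = (s (f n)).2 := fun n => rfl
  let e : ℕ → X := fun n => (s (f n)).1
  have hff : ∀ n k, (f (n + k)).1 * (f n).1 = (f (n + k)).1 := by
    intro n k
    induction k with
    | zero => exact (f n).2.2.1.isIdempotentElem.eq
    | succ k ih =>
      have h1 : (f (n + (k + 1))).1 * (f (n + k)).1 = (f (n + (k + 1))).1 := hs₂ (f (n + k))
      rw [← h1, mul_assoc, ih]
  have hee : ∀ m n, m < n → (e n).1 * (e m).1 = 0 := by
    intro m n hmn
    obtain ⟨k, rfl⟩ := Nat.exists_eq_add_of_le (Nat.succ_le_of_lt hmn)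
    have h1 : (e (m.succ + k)).1 * (f (m.succ + k)).1 = (e (m.succ + k)).1 := hs₁ _
    have h2 : (f m.succ).1 * (e m).1 = 0 :=
      star_mul_eq_zero_comm (e m).2.2.1 (f m.succ).2.2.1 (hs₁₂ (f m))
    rw [← h1, ← hff m.succ k, mul_assoc, mul_assoc, h2, mul_zero, mul_zero]
  have hee' : ∀ m n, m ≠ n → (e m).1 * (e n).1 = 0 := by
    intro m n hmn
    rcases hmn.lt_or_gt with h | h
    · exact star_mul_eq_zero_comm (e n).2.2.1 (e m).2.2.1 (hee m n h)
    · exact hee n m h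
  have hdom : ∀ n, ∃ v ∈ M, star v * v = p ∧ (e n).1 * v = v := by
    intro n
    obtain ⟨z, hzM, hzM', -, hze, v, hvM, hvv, hev⟩ :=
      exists_central_dominated hBM hcomm hpM hp hN (e n).2.1 (e n).2.2.1
    refine ⟨v, hvM, ?_, hev⟩
    -- Full central support of `e n` forces `z` to dominate `c`, so `p z` is all of `p`.
    have hzc : z * c = c := by
      rw [← (e n).2.2.2]
      exact mul_centralSupport_eq_self_of_mem_commutant hzM' hze
    rw [hvv, mem_commutant_iff.mp hzM' p hpM, ← centralSupport_mul M p, ← mul_assoc, ← hc, hzc]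
  choose v hvM hvv hev using hdom
  refine hM.eq_zero_of_orthogonal_sequence v hvM hvv fun m n hmn => ?_
  rw [← hev m, ← hev n, star_mul, (e m).2.2.1.isSelfAdjoint.star_eq, mul_assoc,
    ← mul_assoc (e m).1, hee' m n hmn, zero_mul, mul_zero]

end Finite

end VonNeumannAlgebra

theorem lemma2p6 {H : Type*} [NormedAddCommGroup H] [InnerProductSpace ℂ H] [CompleteSpace H]
    (B M : VonNeumannAlgebra H) (hBM : B ≤ M) (hB : B.IsFinite) (hM : M.IsFinite)
    (hcomm : ∀ x ∈ M, x ∈ B.commutant → x ∈ B)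
    (p : H →L[ℂ] H) (hpM : p ∈ M) (hp : IsStarProjection p) (hp0 : p ≠ 0) :
    ∃ q ∈ B, IsStarProjection q ∧ q ≠ 0 ∧
      ∃ r ∈ M, IsStarProjection r ∧ r ≤ p ∧ M.MvNEquiv q r := by
  by_contra hno
  refine hp0 (VonNeumannAlgebra.eq_zero_of_no_subequivalent hBM hM hcomm hpM hp
    fun q hqB hq r hrM hr hrp hqr => ?_)
  by_contra hq0
  exact hno ⟨q, hqB, hq, hq0, r, hrM, hr, (hr.le_iff_mul_eq_left hp).mpr hrp, hqr⟩
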